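/- Let $d\ge 1$, let $D\subset\mathbb{R}^d$ be a bounded open set, let $h\in L^\infty_{loc}(D)$, and let $\delta>0$, $K>0$ and $\alpha\in[0,1)$. Set $$D_\delta:=\{x\in D : \mathrm{dist}(x,\partial D)>\delta\}.$$ Then there is a constant $C$, depending only on $d$, $D$, $\delta$, $h$, $\alpha$ and $K$, with the following property. Let $u\in H^1(D)$ be such that (a) $0\le u\le h$ almost everywhere in $D$; (b) $u$ is subharmonic in $D$ in the sense of distributions, that is, $\int_D u\,\Delta\varphi\,dx\ge 0$ for every $\varphi\in C^\infty_c(D)$ with $\varphi\ge 0$; let $\Delta u$ denote its distributional Laplacian, i.e. the positive Radon measure on $D$ with $\int_D u\,\Delta\varphi\,dx=\int_D\varphi\,d(\Delta u)$ for every $\varphi\in C^\infty_c(D)$; (c) $\Delta u\big(B_r(x_0)\big)\le K\,r^{d-1-\alpha}$ for every $x_0\in\overline{D_\delta}$ and every $0<r<\delta/2$, where $B_r(x_0)$ is the open ball. Then for every $x\in D$ the limit $\tilde u(x):=\lim_{r\to0^+}\frac{1}{|B_r(x)|}\int_{B_r(x)}u\,dy$ exists and is finite, $\tilde u=u$ almost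 everywhere in $D$, and $$|\tilde u(x)-\tilde u(y)|\le C\,|x-y|^{\frac{1-\alpha}{2-\alpha}}\qquad\text{for all } x,y\in\overline{D_\delta}.$$ -/

import Mathlib

open scoped Distributions Laplacian
open MeasureTheory

/-- `u` belongs to the Sobolev space `H¹(D)`: it is square integrable in `D` and has a weak
gradient `G` (tested against smooth functions with compact support in `D`) which is square
integrable in `D`. As usual, only the values of `u` in `D`, up to null sets, matter. -/
def MemH1 {d : ℕ} (D : TopologicalSpace.Opens (EuclideanSpace ℝ (Fin d)))
    (u : EuclideanSpace ℝ (Fin d) → ℝ) : Prop :=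
  MemLp u 2 (volume.restrict D) ∧
    ∃ G : EuclideanSpace ℝ (Fin d) → EuclideanSpace ℝ (Fin d),
      MemLp G 2 (volume.restrict D) ∧
        ∀ φ : 𝓓(D, ℝ), ∫ x in D, u x • gradient φ x = - ∫ x in D, φ x • G x

/-- `h ∈ L^∞_loc(D)`: on each compact subset of `D`, the function `h` is (a.e. strongly)
measurable and essentially bounded. -/
def MemLinftyLoc {d : ℕ} (D : TopologicalSpace.Opens (EuclideanSpace ℝ (Fin d)))
    (h : EuclideanSpace ℝ (Fin d) → ℝ) : Prop :=
  ∀ K : Set (EuclideanSpace ℝ (Fin d)), IsCompact K → K ⊆ D → MemLp h ⊤ (volume.restrict K)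

/-- `u` is subharmonic in `D` in the sense of distributions: it is locally integrable in `D` and
`∫ u Δφ ≥ 0` for every non-negative smooth function `φ` with compact support in `D`. -/
structure IsSubharmonicIn {d : ℕ} (D : TopologicalSpace.Opens (EuclideanSpace ℝ (Fin d)))
    (u : EuclideanSpace ℝ (Fin d) → ℝ) : Prop where
  locallyIntegrableOn : LocallyIntegrableOn u D
  nonneg : ∀ φ : 𝓓(D, ℝ), (∀ x, 0 ≤ φ x) →
    0 ≤ ∫ x in D, u x * Δ (φ : EuclideanSpace ℝ (Fin d) → ℝ) x

/-- The (positive Radon) measure `μ` on `D` is the distributional Laplacian of `u` in `D`.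
It is regarded as a measure on the whole space which does not charge the complement of `D`. -/
structure IsLaplacianMeasure {d : ℕ} (D : TopologicalSpace.Opens (EuclideanSpace ℝ (Fin d)))
    (u : EuclideanSpace ℝ (Fin d) → ℝ) (μ : Measure (EuclideanSpace ℝ (Fin d))) : Prop where
  compl_eq_zero : μ (D : Set (EuclideanSpace ℝ (Fin d)))ᶜ = 0
  lt_top_of_isCompact : ∀ K : Set (EuclideanSpace ℝ (Fin d)), IsCompact K → K ⊆ D → μ K < ⊤
  integral_eq : ∀ φ : 𝓓(D, ℝ),
    ∫ x in D, u x * Δ (φ : EuclideanSpace ℝ (Fin d) → ℝ) x = ∫ x, φ x ∂μ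

theorem integrable_mul_laplacian {d : ℕ} {D : TopologicalSpace.Opens (EuclideanSpace ℝ (Fin d))}
    {u : EuclideanSpace ℝ (Fin d) → ℝ} (hu : LocallyIntegrableOn u D) (φ : 𝓓(D, ℝ)) :
    IntegrableOn (fun x => u x * Δ (φ : EuclideanSpace ℝ (Fin d) → ℝ) x) D := by
  have hc : Continuous (Δ (φ : EuclideanSpace ℝ (Fin d) → ℝ)) := by
    rw [InnerProductSpace.laplacian_eq_iteratedFDeriv_stdOrthonormalBasis]
    refine continuous_finsetSum _ fun i _ => ?_
    have h2 : Continuous (iteratedFDeriv ℝ 2 (φ : EuclideanSpace ℝ (Fin d) → ℝ)) :=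
      φ.contDiff.continuous_iteratedFDeriv (WithTop.coe_le_coe.2 (le_top : (2 : ℕ∞) ≤ ⊤))
    exact (ContinuousMultilinearMap.apply ℝ (fun _ : Fin 2 => EuclideanSpace ℝ (Fin d)) ℝ
      _).continuous.comp h2
  have hz : ∀ x, x ∉ tsupport φ → Δ (φ : EuclideanSpace ℝ (Fin d) → ℝ) x = 0 := by
    intro x hx
    rw [InnerProductSpace.laplacian_eq_iteratedFDeriv_stdOrthonormalBasis]
    refine Finset.sum_eq_zero fun i _ => ?_
    have : iteratedFDeriv ℝ 2 (φ : EuclideanSpace ℝ (Fin d) → ℝ) x = 0 := by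
      by_contra hne
      exact hx (support_iteratedFDeriv_subset 2 hne)
    rw [this]; rfl
  have hK : IsCompact (tsupport φ) := φ.hasCompactSupport
  have h1 : IntegrableOn (fun x => u x * Δ (φ : EuclideanSpace ℝ (Fin d) → ℝ) x)
      (tsupport φ) :=
    (hu.integrableOn_compact_subset φ.tsupport_subset hK).mul_continuousOn hc.continuousOn hK
  have h2 : Integrable (fun x => u x * Δ (φ : EuclideanSpace ℝ (Fin d) → ℝ) x) := by
    refine (integrableOn_iff_integrable_of_support_subset fun x hx => ?_).1 h1
    by_contra hx'
    exact hx (by simp [hz x hx'])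
  exact h2.integrableOn

theorem exists_testFunction_eq_one {d : ℕ}
    (D : TopologicalSpace.Opens (EuclideanSpace ℝ (Fin d)))
    {K : Set (EuclideanSpace ℝ (Fin d))} (hK : IsCompact K) (hKD : K ⊆ D) :
    ∃ φ : 𝓓(D, ℝ), (∀ x, 0 ≤ φ x) ∧ ∀ x ∈ K, φ x = 1 := by
  obtain ⟨L, hL, hKL, hLD⟩ := exists_compact_between hK D.isOpen hKD
  obtain ⟨f, hf, hr, hs, h1⟩ := exists_contMDiff_support_eq_eq_one_iff
    (modelWithCornersSelf ℝ (EuclideanSpace ℝ (Fin d))) isOpen_interior hK.isClosed hKL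
  have hsub : tsupport f ⊆ L := by
    rw [tsupport, hs]
    exact closure_minimal interior_subset hL.isClosed
  refine ⟨⟨f, hf.contDiff, hL.of_isClosed_subset (isClosed_tsupport f) hsub, hsub.trans hLD⟩,
    fun x => ?_, fun x hx => (h1 x).1 hx⟩
  exact (hr (Set.mem_range_self x)).1

/-- A subharmonic function in the sense of distributions has a Laplacian which is a Radon
measure. -/
theorem IsSubharmonicIn.exists_isLaplacianMeasure {d : ℕ}
    {D : TopologicalSpace.Opens (EuclideanSpace ℝ (Fin d))}
    {u : EuclideanSpace ℝ (Fin d) → ℝ} (hu : IsSubharmonicIn D u) :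
    ∃ μ : Measure (EuclideanSpace ℝ (Fin d)), IsLaplacianMeasure D u μ := by
  have : LocallyCompactSpace D := D.isOpen.locallyCompactSpace
  have hcd : ∀ (φ : 𝓓(D, ℝ)) (x : EuclideanSpace ℝ (Fin d)), ContDiffAt ℝ 2 φ x := fun φ x =>
    (φ.contDiff.of_le (WithTop.coe_le_coe.2 (le_top : (2 : ℕ∞) ≤ ⊤))).contDiffAt
  -- the distributional Laplacian as a linear functional on test functions
  let L : 𝓓(D, ℝ) →ₗ[ℝ] ℝ :=
    { toFun := fun φ => ∫ x in D, u x * Δ (φ : EuclideanSpace ℝ (Fin d) → ℝ) x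
      map_add' := fun φ ψ => by
        rw [← integral_add (integrable_mul_laplacian hu.1 φ) (integrable_mul_laplacian hu.1 ψ)]
        congr 1; ext x
        rw [FunLike.coe_add, (hcd φ x).laplacian_add (hcd ψ x), mul_add]
      map_smul' := fun c φ => by
        rw [RingHom.id_apply, smul_eq_mul, ← integral_const_mul]
        congr 1; ext x
        rw [FunLike.coe_smul, InnerProductSpace.laplacian_smul c (hcd φ x), smul_eq_mul]
        ring }
  -- restriction of test functions to `D`, as compactly supported continuous functions
  have hcs : ∀ φ : 𝓓(D, ℝ), HasCompactSupport (fun x : D => φ x) := by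
    intro φ
    have hK : IsCompact ((Subtype.val : D → EuclideanSpace ℝ (Fin d)) ⁻¹' tsupport φ) := by
      refine Topology.IsInducing.subtypeVal.isCompact_preimage' φ.hasCompactSupport ?_
      rw [Subtype.range_val]; exact φ.tsupport_subset
    refine HasCompactSupport.intro hK fun x hx => ?_
    exact image_eq_zero_of_notMem_tsupport hx
  let J : 𝓓(D, ℝ) →ₗ[ℝ] CompactlySupportedContinuousMap D ℝ :=
    { toFun := fun φ => ⟨⟨fun x => φ x, φ.continuous.comp continuous_subtype_val⟩, hcs φ⟩
      map_add' := fun φ ψ => by ext x; rfl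
      map_smul' := fun c φ => by ext x; rfl }
  have hJ : ∀ φ (x : D), J φ x = φ x := fun _ _ => rfl
  have hout : ∀ (φ : 𝓓(D, ℝ)) x, x ∉ D → φ x = 0 := fun φ x hx =>
    image_eq_zero_of_notMem_tsupport fun h => hx (φ.tsupport_subset h)
  have hJinj : Function.Injective J := by
    intro φ ψ h
    ext x
    by_cases hx : x ∈ D
    · have := congrArg (fun f : CompactlySupportedContinuousMap D ℝ => f ⟨x, hx⟩) h
      exact this
    · rw [hout φ x hx, hout ψ x hx]
  let e := LinearEquiv.ofInjective J hJinj
  let P : PointedCone ℝ (CompactlySupportedContinuousMap D ℝ) :=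
    { carrier := {f | ∀ x, 0 ≤ f x}
      add_mem' := fun {f g} hf hg x => add_nonneg (hf x) (hg x)
      zero_mem' := fun x => le_rfl
      smul_mem' := fun c f hf x => mul_nonneg c.2 (hf x) }
  obtain ⟨Λ, hΛ, hpos⟩ := riesz_extension P ⟨LinearMap.range J, L ∘ₗ e.symm.toLinearMap⟩
    (by
      rintro ⟨_, φ, rfl⟩ hφ
      have he : e.symm ⟨J φ, φ, rfl⟩ = φ := e.symm_apply_eq.2 (Subtype.ext rfl)
      change 0 ≤ L (e.symm ⟨J φ, φ, rfl⟩)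
      rw [he]
      refine hu.2 φ fun x => ?_
      by_cases hx : x ∈ D
      · exact hφ ⟨x, hx⟩
      · exact (hout φ x hx).ge)
    (by
      intro f
      have hK : IsCompact ((Subtype.val : D → EuclideanSpace ℝ (Fin d)) '' tsupport f) :=
        f.hasCompactSupport.isCompact.image continuous_subtype_val
      obtain ⟨φ, hφ0, hφ1⟩ := exists_testFunction_eq_one D hK (by rintro _ ⟨x, -, rfl⟩; exact x.2)
      obtain ⟨C, hC⟩ := f.hasCompactSupport.exists_bound_of_continuous f.continuous
      refine ⟨⟨J (|C| • φ), _, rfl⟩, fun x => ?_⟩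
      change 0 ≤ |C| * φ x + f x
      by_cases hx : x ∈ tsupport f
      · rw [hφ1 x ⟨x, hx, rfl⟩]
        have := (abs_le.1 (hC x)).1
        have := le_abs_self C
        linarith
      · rw [image_eq_zero_of_notMem_tsupport hx, add_zero]
        exact mul_nonneg (abs_nonneg _) (hφ0 _))
  let Λp : CompactlySupportedContinuousMap D ℝ →ₚ[ℝ] ℝ :=
    PositiveLinearMap.mk₀ Λ fun f hf => hpos f hf
  have hemb : MeasurableEmbedding (Subtype.val : D → EuclideanSpace ℝ (Fin d)) :=
    MeasurableEmbedding.subtype_coe D.isOpen.measurableSet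
  refine ⟨(RealRMK.rieszMeasure Λp).map Subtype.val, ?_, ?_, ?_⟩
  · rw [hemb.map_apply]
    convert measure_empty
    · ext x; simp
    · infer_instance
  · intro K hK hKD
    rw [hemb.map_apply]
    refine IsCompact.measure_lt_top
      (Topology.IsInducing.subtypeVal.isCompact_preimage' hK ?_)
    rw [Subtype.range_val]; exact hKD
  · intro φ
    rw [hemb.integral_map]
    have h1 := RealRMK.integral_rieszMeasure Λp (J φ)
    have h2 : Λ (J φ) = L (e.symm ⟨J φ, φ, rfl⟩) := hΛ ⟨J φ, φ, rfl⟩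
    have he : e.symm ⟨J φ, φ, rfl⟩ = φ := e.symm_apply_eq.2 (Subtype.ext rfl)
    rw [he] at h2
    exact h2.symm.trans h1.symm

/-- The distributional Laplacian `Δu` of a subharmonic function `u` in `D`: the positive Radon
measure on `D` with `∫ u Δφ = ∫ φ d(Δu)` for all test functions `φ` on `D` (this identity
determines the measure). -/
noncomputable def laplacianMeasure {d : ℕ}
    (D : TopologicalSpace.Opens (EuclideanSpace ℝ (Fin d)))
    (u : EuclideanSpace ℝ (Fin d) → ℝ) (hu : IsSubharmonicIn D u) :
    Measure (EuclideanSpace ℝ (Fin d)) :=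
  hu.exists_isLaplacianMeasure.choose

theorem isLaplacianMeasure_laplacianMeasure {d : ℕ}
    {D : TopologicalSpace.Opens (EuclideanSpace ℝ (Fin d))}
    {u : EuclideanSpace ℝ (Fin d) → ℝ} (hu : IsSubharmonicIn D u) :
    IsLaplacianMeasure D u (laplacianMeasure D u hu) :=
  hu.exists_isLaplacianMeasure.choose_spec

/-- `D_δ = {x ∈ D : dist(x, ∂D) > δ}`. -/
def innerSet {d : ℕ} (D : TopologicalSpace.Opens (EuclideanSpace ℝ (Fin d))) (δ : ℝ) :
    Set (EuclideanSpace ℝ (Fin d)) :=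
  {x | x ∈ D ∧ δ < Metric.infDist x (frontier (D : Set (EuclideanSpace ℝ (Fin d))))}

/-- `v` is the precise representative of `u` in `D`: it equals `u` almost everywhere in `D`, and at
every point of `D` its value is the limit of the averages of `u` over small balls. -/
def IsPreciseRepresentative {d : ℕ} (D : TopologicalSpace.Opens (EuclideanSpace ℝ (Fin d)))
    (u v : EuclideanSpace ℝ (Fin d) → ℝ) : Prop :=
  v =ᵐ[volume.restrict D] u ∧
    ∀ x ∈ D, Filter.Tendsto (fun r : ℝ => ⨍ y in Metric.ball x r, u y)
      (nhdsWithin 0 (Set.Ioi 0)) (nhds (v x))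

/-! ### Laplacians of radial functions. -/

section Radial

variable {d : ℕ}

/-! Write `μ` for the distributional Laplacian of `u`. The normalised mean `r ^ (-d) ∫_{B_r(x)} u`
has radial derivative `r ^ (1-d) / 2 * ∫ (1 - |y-x|² / r²)₊ dμ(y)`. This is nonnegative, so averages
increase with `r` and, being bounded below by `0`, converge as `r → 0`. It is also at most `r ^
(1-d) / 2 * μ(B_r(x)) ≤ K r ^ (-α) / 2`, so an average over `B_r(x)` exceeds its limit by at most a
constant times `r ^ (1-α)` (`average_ball_sub_limit_mem`).

The derivative formula is proved with the indicator of the ball replaced by smooth radial cutoffs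
(`hasDerivAt_smoothMean`), for which differentiation in `r` produces exactly the Laplacian of an
admissible test function. The resulting inequalities then pass to the limit (`tendsto_smoothMean`).

Averages over `B_r(x)` and `B_r(y)` differ by at most `M d |x-y| / r` when `0 ≤ u ≤ M`
(`average_ball_sub_average_ball_le`). Taking `r` proportional to `|x-y| ^ (1/(2-α))` makes both
errors of order `|x-y| ^ ((1-α)/(2-α))`. Lebesgue differentiation identifies the limit with `u`
almost everywhere. -/

theorem hasFDerivAt_comp_norm_sub_sq {f f' : ℝ → ℝ} (hf : ∀ t, HasDerivAt f (f' t) t)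
    (x y : EuclideanSpace ℝ (Fin d)) :
    HasFDerivAt (fun z => f (‖z - x‖ ^ 2)) ((2 * f' (‖y - x‖ ^ 2)) • innerSL ℝ (y - x)) y := by
  have h1 : HasFDerivAt (fun z : EuclideanSpace ℝ (Fin d) => ‖z - x‖ ^ 2)
      (2 • innerSL ℝ (y - x)) y :=
    ((hasStrictFDerivAt_norm_sq (y - x)).hasFDerivAt.comp y
      ((hasFDerivAt_id y).sub_const x) :)
  refine ((hf (‖y - x‖ ^ 2)).comp_hasFDerivAt y h1).congr_fderiv ?_
  ext z
  simp
  ring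

/-- The Laplacian of a radial function, written as a function of the squared radius. -/
theorem laplacian_comp_norm_sub_sq {f f' f'' : ℝ → ℝ} (hf : ∀ t, HasDerivAt f (f' t) t)
    (hf' : ∀ t, HasDerivAt f' (f'' t) t) (x y : EuclideanSpace ℝ (Fin d)) :
    Δ (fun z => f (‖z - x‖ ^ 2)) y =
      4 * ‖y - x‖ ^ 2 * f'' (‖y - x‖ ^ 2) + 2 * d * f' (‖y - x‖ ^ 2) := by
  let b := stdOrthonormalBasis ℝ (EuclideanSpace ℝ (Fin d))
  have h1 : fderiv ℝ (fun z : EuclideanSpace ℝ (Fin d) => f (‖z - x‖ ^ 2)) =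
      fun z => (2 * f' (‖z - x‖ ^ 2)) • innerSL ℝ (z - x) :=
    funext fun z => (hasFDerivAt_comp_norm_sub_sq hf x z).fderiv
  have h2 := ((hasFDerivAt_comp_norm_sub_sq hf' x y).const_mul 2).smul
    ((innerSL ℝ).hasFDerivAt.comp y ((hasFDerivAt_id y).sub_const x))
  have h3 : ∀ i, iteratedFDeriv ℝ 2 (fun z : EuclideanSpace ℝ (Fin d) => f (‖z - x‖ ^ 2)) y
      ![b i, b i] = 4 * f'' (‖y - x‖ ^ 2) * inner ℝ (b i) (y - x) ^ 2 + 2 * f' (‖y - x‖ ^ 2) := by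
    intro i
    rw [iteratedFDeriv_two_apply, h1]
    erw [h2.fderiv]
    have hb : inner ℝ (b i) (b i) = 1 := by
      rw [real_inner_self_eq_norm_sq, b.orthonormal.1 i]; norm_num
    have hc : inner ℝ (y - x) (b i) = inner ℝ (b i) (y - x) := real_inner_comm _ _
    change (2 * f' (‖y - x‖ ^ 2)) * inner ℝ (b i) (b i) +
      (2 * (2 * f'' (‖y - x‖ ^ 2) * inner ℝ (y - x) (b i))) * inner ℝ (y - x) (b i) = _
    rw [hb, hc]
    ring
  rw [InnerProductSpace.laplacian_eq_iteratedFDeriv_orthonormalBasis _ b]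
  simp_rw [h3]
  rw [Finset.sum_add_distrib, ← Finset.mul_sum]
  have h4 : ∑ i, inner ℝ (b i) (y - x) ^ 2 = ‖y - x‖ ^ 2 := by
    simpa using b.sum_sq_norm_inner_right (y - x)
  rw [h4]
  simp
  ring

end Radial

/-! ### Smooth one-variable cutoffs and their primitives. -/

section Profile

/-- A smooth approximation from below of the indicator function of `(-∞, 1)`. -/
noncomputable def smoothCutoff (n : ℕ) (t : ℝ) : ℝ := Real.smoothTransition (n * (1 - t))

/-- The primitive of `-smoothCutoff n` that vanishes on `[1, ∞)`. -/
noncomputable def smoothCutoffPrimitive (n : ℕ) (t : ℝ) : ℝ := ∫ s in t..1, smoothCutoff n s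

theorem contDiff_smoothCutoff (n : ℕ) {m : ℕ∞} : ContDiff ℝ m (smoothCutoff n) :=
  Real.smoothTransition.contDiff.comp (by fun_prop)

theorem smoothCutoff_of_one_le (n : ℕ) {t : ℝ} (ht : 1 ≤ t) : smoothCutoff n t = 0 :=
  Real.smoothTransition.zero_of_nonpos
    (mul_nonpos_of_nonneg_of_nonpos (Nat.cast_nonneg n) (by linarith))

theorem smoothCutoff_nonneg (n : ℕ) (t : ℝ) : 0 ≤ smoothCutoff n t :=
  Real.smoothTransition.nonneg _

theorem smoothCutoff_le_one (n : ℕ) (t : ℝ) : smoothCutoff n t ≤ 1 :=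
  Real.smoothTransition.le_one _

/-- For each `t < 1` the sequence is eventually constant. At `t = 1` every term vanishes, so the
limit is the indicator of the open half-line and later yields open balls. -/
theorem tendsto_smoothCutoff (t : ℝ) :
    Filter.Tendsto (fun n => smoothCutoff n t) Filter.atTop
      (nhds (Set.indicator (Set.Iio 1) 1 t)) := by
  by_cases ht : t < 1
  · rw [Set.indicator_of_mem (Set.mem_Iio.2 ht)]
    obtain ⟨N, hN⟩ := exists_nat_ge (1 / (1 - t))
    refine tendsto_const_nhds.congr' ?_
    filter_upwards [Filter.eventually_ge_atTop N] with n hn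
    have hp : 0 < 1 - t := by linarith
    refine (Real.smoothTransition.one_of_one_le ?_).symm
    rw [← div_le_iff₀ hp]
    exact hN.trans (by exact_mod_cast hn)
  · rw [Set.indicator_of_notMem (by simpa using ht)]
    simp_rw [smoothCutoff_of_one_le _ (not_lt.1 ht)]
    exact tendsto_const_nhds

theorem hasDerivAt_smoothCutoff (n : ℕ) (t : ℝ) :
    HasDerivAt (smoothCutoff n) (deriv (smoothCutoff n) t) t :=
  ((contDiff_smoothCutoff n (m := 1)).differentiable (by norm_num) t).hasDerivAt

theorem hasDerivAt_smoothCutoffPrimitive (n : ℕ) (t : ℝ) :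
    HasDerivAt (smoothCutoffPrimitive n) (-smoothCutoff n t) t := by
  have hc : Continuous (smoothCutoff n) := (contDiff_smoothCutoff n (m := 0)).continuous
  exact intervalIntegral.integral_hasDerivAt_left (hc.intervalIntegrable _ _)
    hc.stronglyMeasurable.stronglyMeasurableAtFilter hc.continuousAt

theorem contDiff_smoothCutoffPrimitive (n : ℕ) : ContDiff ℝ (⊤ : ℕ∞) (smoothCutoffPrimitive n) := by
  rw [contDiff_infty_iff_deriv]
  refine ⟨fun t => (hasDerivAt_smoothCutoffPrimitive n t).differentiableAt, ?_⟩
  rw [show deriv (smoothCutoffPrimitive n) = fun t => -smoothCutoff n t from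
    funext fun t => (hasDerivAt_smoothCutoffPrimitive n t).deriv]
  exact (contDiff_smoothCutoff n).neg

theorem smoothCutoffPrimitive_of_one_le (n : ℕ) {t : ℝ} (ht : 1 ≤ t) :
    smoothCutoffPrimitive n t = 0 := by
  refine (intervalIntegral.integral_congr (g := fun _ => (0 : ℝ)) fun s hs => ?_).trans (by simp)
  rw [Set.uIcc_of_ge ht] at hs
  exact smoothCutoff_of_one_le n hs.1

theorem smoothCutoffPrimitive_nonneg (n : ℕ) (t : ℝ) : 0 ≤ smoothCutoffPrimitive n t := by
  rcases le_total t 1 with ht | ht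
  · exact intervalIntegral.integral_nonneg ht fun s _ => smoothCutoff_nonneg n s
  · exact (smoothCutoffPrimitive_of_one_le n ht).ge

theorem smoothCutoffPrimitive_le_one (n : ℕ) {t : ℝ} (ht : 0 ≤ t) :
    smoothCutoffPrimitive n t ≤ 1 := by
  rcases le_total t 1 with h1 | h1
  · have hc : Continuous (smoothCutoff n) := (contDiff_smoothCutoff n (m := 0)).continuous
    have := intervalIntegral.integral_mono_on h1 (hc.intervalIntegrable _ _)
      (continuous_const.intervalIntegrable _ _ : IntervalIntegrable (fun _ => (1 : ℝ)) volume t 1)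
      fun s _ => smoothCutoff_le_one n s
    simp only [intervalIntegral.integral_const, smul_eq_mul, mul_one] at this
    unfold smoothCutoffPrimitive
    linarith
  · rw [smoothCutoffPrimitive_of_one_le n h1]; exact zero_le_one

end Profile

/-! ### Radial test functions and the derivative of the smoothed mean. -/

section RadialTest

variable {d : ℕ}

/-- The smooth bump `y ↦ ψ(|y - x|² / r²)`, where `ψ` is the primitive of minus the cutoff. -/
noncomputable def radialBump (n : ℕ) (x : EuclideanSpace ℝ (Fin d)) (r : ℝ)
    (y : EuclideanSpace ℝ (Fin d)) : ℝ :=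
  smoothCutoffPrimitive n ((r ^ 2)⁻¹ * ‖y - x‖ ^ 2)

theorem one_le_scaled_norm_sq {x y : EuclideanSpace ℝ (Fin d)} {r : ℝ} (hr : 0 < r)
    (hy : r ≤ ‖y - x‖) : 1 ≤ (r ^ 2)⁻¹ * ‖y - x‖ ^ 2 := by
  rw [inv_mul_eq_div, one_le_div (by positivity)]
  gcongr

theorem radialBump_eq_zero (n : ℕ) {x y : EuclideanSpace ℝ (Fin d)} {r : ℝ} (hr : 0 < r)
    (hy : y ∉ Metric.ball x r) : radialBump n x r y = 0 :=
  smoothCutoffPrimitive_of_one_le n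
    (one_le_scaled_norm_sq hr (by simpa [dist_eq_norm] using hy))

theorem contDiff_radialBump (n : ℕ) (x : EuclideanSpace ℝ (Fin d)) (r : ℝ) :
    ContDiff ℝ (⊤ : ℕ∞) (radialBump n x r) :=
  (contDiff_smoothCutoffPrimitive n).comp
    (contDiff_const.mul ((contDiff_id.sub contDiff_const).norm_sq ℝ))

theorem tsupport_radialBump_subset (n : ℕ) (x : EuclideanSpace ℝ (Fin d)) {r : ℝ} (hr : 0 < r) :
    tsupport (radialBump n x r) ⊆ Metric.closedBall x r := by
  refine closure_minimal (fun y hy => ?_) Metric.isClosed_closedBall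
  by_contra h
  exact hy (radialBump_eq_zero n hr fun h' => h (Metric.ball_subset_closedBall h'))

/-- The radial bump as a test function. -/
noncomputable def radialTestFunction {D : TopologicalSpace.Opens (EuclideanSpace ℝ (Fin d))}
    (n : ℕ) (x : EuclideanSpace ℝ (Fin d)) {r : ℝ} (hr : 0 < r)
    (hD : Metric.closedBall x r ⊆ D) : 𝓓(D, ℝ) :=
  ⟨radialBump n x r, contDiff_radialBump n x r,
    (isCompact_closedBall x r).of_isClosed_subset (isClosed_tsupport _)
      (tsupport_radialBump_subset n x hr), (tsupport_radialBump_subset n x hr).trans hD⟩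

/-- The radial derivative, at squared distance `q`, of the mass-normalised cutoff. -/
noncomputable def scaledCutoffDeriv (d n : ℕ) (ρ q : ℝ) : ℝ :=
  ρ / (2 * ρ ^ d) * (4 * q * (-((ρ ^ 2)⁻¹ ^ 2 * deriv (smoothCutoff n) ((ρ ^ 2)⁻¹ * q))) +
    2 * d * (-((ρ ^ 2)⁻¹ * smoothCutoff n ((ρ ^ 2)⁻¹ * q))))

/-- With `η` the cutoff, the derivative is `-d ρ ^ (-d-1) η - 2 q ρ ^ (-d-3) η'`. The definition of
`scaledCutoffDeriv` arranges the same terms in the shape `4 q f'' + 2 d f'` of a radial Laplacian.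
-/
theorem hasDerivAt_scaledCutoff (d n : ℕ) {ρ : ℝ} (hρ : 0 < ρ) (q : ℝ) :
    HasDerivAt (fun ρ : ℝ => (ρ ^ d)⁻¹ * smoothCutoff n ((ρ ^ 2)⁻¹ * q))
      (scaledCutoffDeriv d n ρ q) ρ := by
  have h1 := (hasDerivAt_pow d ρ).inv (pow_ne_zero d hρ.ne')
  have h2 := ((hasDerivAt_pow 2 ρ).inv (pow_ne_zero 2 hρ.ne')).mul_const q
  have h3 := h1.mul ((hasDerivAt_smoothCutoff n ((ρ ^ 2)⁻¹ * q)).comp ρ h2)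
  refine h3.congr_deriv ?_
  -- The exponent `d - 1` is truncated at `d = 0`, where the factor `d` makes both sides vanish.
  have h4 : (d : ℝ) * ρ ^ (d - 1) = d * ρ ^ d / ρ := by
    rcases d with _ | d
    · simp
    · rw [Nat.add_sub_cancel, pow_succ]; field_simp
  unfold scaledCutoffDeriv
  simp only [Pi.inv_apply, Function.comp_apply]
  rw [h4]
  have h5 : ρ ^ d ≠ 0 := pow_ne_zero d hρ.ne'
  generalize ρ ^ d = P at *
  push_cast
  field_simp
  ring

theorem scaledCutoffDeriv_norm_sub_sq (n : ℕ) (x : EuclideanSpace ℝ (Fin d)) (r : ℝ)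
    (y : EuclideanSpace ℝ (Fin d)) :
    scaledCutoffDeriv d n r (‖y - x‖ ^ 2) = r / (2 * r ^ d) * Δ (radialBump n x r) y := by
  have hl : ∀ t, HasDerivAt (fun t : ℝ => (r ^ 2)⁻¹ * t) ((r ^ 2)⁻¹) t := fun t => by
    simpa using (hasDerivAt_id t).const_mul ((r ^ 2)⁻¹)
  have h1 : ∀ t, HasDerivAt (fun t => smoothCutoffPrimitive n ((r ^ 2)⁻¹ * t))
      (-((r ^ 2)⁻¹ * smoothCutoff n ((r ^ 2)⁻¹ * t))) t := fun t =>
    ((hasDerivAt_smoothCutoffPrimitive n _).comp t (hl t)).congr_deriv (by ring)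
  have h2 : ∀ t, HasDerivAt (fun t => -((r ^ 2)⁻¹ * smoothCutoff n ((r ^ 2)⁻¹ * t)))
      (-((r ^ 2)⁻¹ ^ 2 * deriv (smoothCutoff n) ((r ^ 2)⁻¹ * t))) t := fun t =>
    ((((hasDerivAt_smoothCutoff n _).comp t (hl t)).const_mul _).neg).congr_deriv (by ring)
  have h3 := laplacian_comp_norm_sub_sq h1 h2 x y
  unfold radialBump
  rw [h3]
  rfl

/-- Keeping the radius away from `0` gives a uniform bound on a compact rectangle, which dominates
the derivative under the integral sign. -/
theorem continuousOn_scaledCutoffDeriv (d n : ℕ) {a b c : ℝ} (ha : 0 < a) :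
    ContinuousOn (fun p : ℝ × ℝ => scaledCutoffDeriv d n p.1 p.2)
      (Set.Icc a b ×ˢ Set.Icc 0 c) := by
  have hη : Continuous (smoothCutoff n) := (contDiff_smoothCutoff n (m := 0)).continuous
  have hη' : Continuous (deriv (smoothCutoff n)) :=
    (contDiff_smoothCutoff n (m := 1)).continuous_deriv le_rfl
  have hp : ∀ p ∈ Set.Icc a b ×ˢ Set.Icc 0 c, p.1 ≠ 0 := fun p hp => (ha.trans_le hp.1.1).ne'
  have hi : ContinuousOn (fun p : ℝ × ℝ => (p.1 ^ 2)⁻¹) (Set.Icc a b ×ˢ Set.Icc 0 c) :=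
    (by fun_prop : ContinuousOn (fun p : ℝ × ℝ => p.1 ^ 2) _).inv₀
      fun p h => pow_ne_zero _ (hp p h)
  have hq : ContinuousOn (fun p : ℝ × ℝ => (p.1 ^ 2)⁻¹ * p.2) (Set.Icc a b ×ˢ Set.Icc 0 c) :=
    hi.mul continuousOn_snd
  have hd : ContinuousOn (fun p : ℝ × ℝ => p.1 / (2 * p.1 ^ d)) (Set.Icc a b ×ˢ Set.Icc 0 c) :=
    continuousOn_fst.div (by fun_prop) fun p h => mul_ne_zero two_ne_zero (pow_ne_zero _ (hp p h))
  unfold scaledCutoffDeriv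
  exact hd.mul (((continuousOn_const.mul continuousOn_snd).mul
    ((hi.pow 2).mul (hη'.comp_continuousOn hq)).neg).add
    (continuousOn_const.mul (hi.mul (hη.comp_continuousOn hq)).neg))

variable {D : TopologicalSpace.Opens (EuclideanSpace ℝ (Fin d))}
  {u : EuclideanSpace ℝ (Fin d) → ℝ} {μ : Measure (EuclideanSpace ℝ (Fin d))}
  {x : EuclideanSpace ℝ (Fin d)}

/-- The smooth counterpart of `r ^ (-d) * ∫ y in ball x r, u y`. -/
noncomputable def smoothMean (n : ℕ) (u : EuclideanSpace ℝ (Fin d) → ℝ)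
    (x : EuclideanSpace ℝ (Fin d)) (R r : ℝ) : ℝ :=
  ∫ y in Metric.closedBall x R, u y * ((r ^ d)⁻¹ * smoothCutoff n ((r ^ 2)⁻¹ * ‖y - x‖ ^ 2))

theorem continuous_smoothCutoff_norm_sq (n : ℕ) (x : EuclideanSpace ℝ (Fin d)) (a b : ℝ) :
    Continuous fun y => a * smoothCutoff n (b * ‖y - x‖ ^ 2) := by
  have hη : Continuous (smoothCutoff n) := (contDiff_smoothCutoff n (m := 0)).continuous
  fun_prop

/-- The domain of integration does not move with `r`, so only the kernel is differentiated. Its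
derivative is a multiple of the Laplacian of the radial bump, and the defining identity of `μ` turns
the integral against `u` into one against `μ`. -/
theorem hasDerivAt_smoothMean (n : ℕ) (hu : LocallyIntegrableOn u D)
    (hμ : IsLaplacianMeasure D u μ) {r R : ℝ} (hr : 0 < r) (hrR : r < R)
    (hR : Metric.closedBall x R ⊆ D) :
    HasDerivAt (smoothMean n u x R) (r / (2 * r ^ d) * ∫ y, radialBump n x r y ∂μ) r := by
  have hint : IntegrableOn u (Metric.closedBall x R) :=
    hu.integrableOn_compact_subset hR (isCompact_closedBall x R)
  have hcont : ∀ ρ : ℝ, Continuous fun y : EuclideanSpace ℝ (Fin d) =>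
      (ρ ^ d)⁻¹ * smoothCutoff n ((ρ ^ 2)⁻¹ * ‖y - x‖ ^ 2) := fun ρ =>
    continuous_smoothCutoff_norm_sq n x _ _
  have hη' : Continuous (deriv (smoothCutoff n)) :=
    (contDiff_smoothCutoff n (m := 1)).continuous_deriv le_rfl
  have hη : Continuous (smoothCutoff n) := (contDiff_smoothCutoff n (m := 0)).continuous
  obtain ⟨B, hB⟩ := (isCompact_Icc.prod isCompact_Icc).exists_bound_of_continuousOn
    (continuousOn_scaledCutoffDeriv d n (a := r / 2) (b := R) (c := R ^ 2) (half_pos hr))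
  have key := (hasDerivAt_integral_of_dominated_loc_of_deriv_le
    (μ := volume.restrict (Metric.closedBall x R)) (x₀ := r) (s := Set.Icc (r / 2) R)
    (F := fun ρ y => u y * ((ρ ^ d)⁻¹ * smoothCutoff n ((ρ ^ 2)⁻¹ * ‖y - x‖ ^ 2)))
    (F' := fun ρ y => u y * scaledCutoffDeriv d n ρ (‖y - x‖ ^ 2))
    (bound := fun y => ‖u y‖ * B)
    (Icc_mem_nhds (by linarith) hrR)
    (Filter.Eventually.of_forall fun ρ =>
      hint.aestronglyMeasurable.mul (hcont ρ).aestronglyMeasurable)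
    (hint.mul_continuousOn (hcont r).continuousOn (isCompact_closedBall x R))
    (hint.aestronglyMeasurable.mul (Continuous.aestronglyMeasurable (by
      unfold scaledCutoffDeriv; fun_prop)))
    (by
      filter_upwards [ae_restrict_mem Metric.isClosed_closedBall.measurableSet] with y hy ρ hρ
      rw [norm_mul]
      refine mul_le_mul_of_nonneg_left (hB (ρ, ‖y - x‖ ^ 2) ⟨hρ, by positivity, ?_⟩)
        (norm_nonneg _)
      rw [Metric.mem_closedBall, dist_eq_norm] at hy
      simp only
      gcongr)
    (hint.norm.mul_const B)
    (Filter.Eventually.of_forall fun y ρ hρ =>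
      (hasDerivAt_scaledCutoff d n ((half_pos hr).trans_le hρ.1) _).const_mul (u y))).2
  refine key.congr_deriv ?_
  have hrD : Metric.closedBall x r ⊆ D := (Metric.closedBall_subset_closedBall hrR.le).trans hR
  have htest := hμ.integral_eq (radialTestFunction n x hr hrD)
  change ∫ y in D, u y * Δ (radialBump n x r) y = ∫ y, radialBump n x r y ∂μ at htest
  rw [← htest, ← integral_const_mul,
    setIntegral_eq_of_subset_of_forall_sdiff_eq_zero D.isOpen.measurableSet hR]
  · refine integral_congr_ae (Filter.Eventually.of_forall fun y => ?_)
    simp only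
    rw [scaledCutoffDeriv_norm_sub_sq n x r]
    ring
  -- Off the larger closed ball the bump vanishes in a whole neighbourhood, hence so does its
  -- Laplacian.
  · intro y hy
    have h0 : radialBump n x r =ᶠ[nhds y] fun _ => 0 := by
      filter_upwards [Metric.isClosed_closedBall.isOpen_compl.mem_nhds hy.2] with z hz
      exact radialBump_eq_zero n hr fun h => hz
        (Metric.ball_subset_closedBall (Metric.ball_subset_ball hrR.le h))
    rw [(InnerProductSpace.laplacian_congr_nhds h0).eq_of_nhds]
    have hc : Δ (fun _ : EuclideanSpace ℝ (Fin d) => (0 : ℝ)) = 0 := by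
      exact InnerProductSpace.laplacian_const
    rw [hc]; simp

theorem integral_radialBump_nonneg (n : ℕ) (x : EuclideanSpace ℝ (Fin d)) (r : ℝ) :
    0 ≤ ∫ y, radialBump n x r y ∂μ :=
  integral_nonneg fun _ => smoothCutoffPrimitive_nonneg n _

theorem integral_radialBump_le (n : ℕ) {r m : ℝ} (hr : 0 < r) (hm : 0 ≤ m)
    (h : μ (Metric.ball x r) ≤ ENNReal.ofReal m) :
    ∫ y, radialBump n x r y ∂μ ≤ m := by
  rw [← setIntegral_eq_integral_of_forall_compl_eq_zero
    (fun y hy => radialBump_eq_zero n hr hy : ∀ y ∉ Metric.ball x r, _)]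
  have hfin : μ (Metric.ball x r) < ⊤ := h.trans_lt ENNReal.ofReal_lt_top
  have h1 := norm_setIntegral_le_of_norm_le_const (f := radialBump n x r) (C := 1) hfin
    fun y _ => by
      rw [radialBump, Real.norm_of_nonneg (smoothCutoffPrimitive_nonneg n _)]
      exact smoothCutoffPrimitive_le_one n (by positivity)
  rw [one_mul] at h1
  exact (le_abs_self _).trans (h1.trans (ENNReal.toReal_le_of_le_ofReal hm h))

end RadialTest

/-! ### Monotonicity, growth and comparison of ball averages. -/

section BallMean

variable {d : ℕ} {D : TopologicalSpace.Opens (EuclideanSpace ℝ (Fin d))}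
  {u : EuclideanSpace ℝ (Fin d) → ℝ} {μ : Measure (EuclideanSpace ℝ (Fin d))}
  {x : EuclideanSpace ℝ (Fin d)}

theorem tendsto_smoothMean {r R : ℝ} (hr : 0 < r) (hrR : r < R)
    (hint : IntegrableOn u (Metric.closedBall x R)) :
    Filter.Tendsto (fun n => smoothMean n u x R r) Filter.atTop
      (nhds ((r ^ d)⁻¹ * ∫ y in Metric.ball x r, u y)) := by
  have hrd : 0 < (r ^ d)⁻¹ := by positivity
  have hlim : (r ^ d)⁻¹ * ∫ y in Metric.ball x r, u y =
      ∫ y in Metric.closedBall x R,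
        u y * ((r ^ d)⁻¹ * Set.indicator (Set.Iio 1) 1 ((r ^ 2)⁻¹ * ‖y - x‖ ^ 2)) := by
    have h1 : ∀ y, u y * ((r ^ d)⁻¹ * Set.indicator (Set.Iio 1) 1 ((r ^ 2)⁻¹ * ‖y - x‖ ^ 2)) =
        (Metric.ball x r).indicator (fun y => (r ^ d)⁻¹ * u y) y := by
      intro y
      by_cases hy : y ∈ Metric.ball x r
      · have h2 : (r ^ 2)⁻¹ * ‖y - x‖ ^ 2 ∈ Set.Iio (1 : ℝ) := by
          rw [Metric.mem_ball, dist_eq_norm] at hy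
          rw [Set.mem_Iio, inv_mul_eq_div, div_lt_one (by positivity)]
          gcongr
        rw [Set.indicator_of_mem hy, Set.indicator_of_mem h2, Pi.one_apply]
        ring
      · have h2 : (r ^ 2)⁻¹ * ‖y - x‖ ^ 2 ∉ Set.Iio (1 : ℝ) :=
          not_lt.2 (one_le_scaled_norm_sq hr (by simpa [dist_eq_norm] using hy))
        rw [Set.indicator_of_notMem hy, Set.indicator_of_notMem h2]
        ring
    simp_rw [h1]
    rw [integral_indicator Metric.isOpen_ball.measurableSet,
      Measure.restrict_restrict Metric.isOpen_ball.measurableSet,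
      Set.inter_eq_left.2 (Metric.ball_subset_closedBall.trans
        (Metric.closedBall_subset_closedBall hrR.le)), integral_const_mul]
  rw [hlim]
  refine tendsto_integral_of_dominated_convergence (fun y => ‖u y‖ * (r ^ d)⁻¹)
    (fun n => hint.aestronglyMeasurable.mul
      (continuous_smoothCutoff_norm_sq n x _ _).aestronglyMeasurable)
    (hint.norm.mul_const _) (fun n => Filter.Eventually.of_forall fun y => ?_)
    (Filter.Eventually.of_forall fun y => ((tendsto_smoothCutoff _).const_mul _).const_mul _)
  rw [norm_mul, norm_mul, Real.norm_of_nonneg hrd.le, Real.norm_of_nonneg (smoothCutoff_nonneg n _)]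
  exact mul_le_mul_of_nonneg_left (mul_le_of_le_one_right hrd.le (smoothCutoff_le_one n _))
    (norm_nonneg _)

/-- Averages of a subharmonic function over concentric balls increase with the radius. -/
theorem scaled_integral_ball_mono (hu : LocallyIntegrableOn u D)
    (hμ : IsLaplacianMeasure D u μ) {R : ℝ} (hR : Metric.closedBall x R ⊆ D) :
    MonotoneOn (fun r => (r ^ d)⁻¹ * ∫ y in Metric.ball x r, u y) (Set.Ioo 0 R) := by
  intro s hs r hr hsr
  have hint := hu.integrableOn_compact_subset hR (isCompact_closedBall x R)
  refine le_of_tendsto_of_tendsto' (tendsto_smoothMean hs.1 hs.2 hint)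
    (tendsto_smoothMean hr.1 hr.2 hint) fun n => ?_
  have hd : ∀ ρ ∈ Set.Ioo 0 R, HasDerivAt (smoothMean n u x R) _ ρ := fun ρ hρ =>
    hasDerivAt_smoothMean n hu hμ hρ.1 hρ.2 hR
  refine monotoneOn_of_deriv_nonneg (convex_Ioo 0 R)
    (fun ρ hρ => (hd ρ hρ).continuousAt.continuousWithinAt)
    (fun ρ hρ => (hd ρ (interior_subset hρ)).differentiableAt.differentiableWithinAt)
    (fun ρ hρ => ?_) hs hr hsr
  have hρ' := interior_subset hρ
  rw [(hd ρ hρ').deriv]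
  have := hρ'.1
  exact mul_nonneg (by positivity) (integral_radialBump_nonneg n x ρ)

/-- A growth bound for the Laplacian on balls controls the growth of the averages. -/
theorem scaled_integral_ball_sub_le (hu : LocallyIntegrableOn u D)
    (hμ : IsLaplacianMeasure D u μ) {R K α : ℝ} (hR : Metric.closedBall x R ⊆ D)
    (hK : 0 ≤ K) (hα : α < 1)
    (hg : ∀ r, 0 < r → r < R →
      μ (Metric.ball x r) ≤ ENNReal.ofReal (K * r ^ ((d : ℝ) - 1 - α)))
    {s r : ℝ} (hs : 0 < s) (hsr : s ≤ r) (hrR : r < R) :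
    (r ^ d)⁻¹ * (∫ y in Metric.ball x r, u y) - (s ^ d)⁻¹ * (∫ y in Metric.ball x s, u y) ≤
      K / (2 * (1 - α)) * r ^ (1 - α) := by
  have hint := hu.integrableOn_compact_subset hR (isCompact_closedBall x R)
  have hα' : 0 < 1 - α := by linarith
  refine le_of_tendsto' ((tendsto_smoothMean (hs.trans_le hsr) hrR hint).sub
    (tendsto_smoothMean hs (hsr.trans_lt hrR) hint)) fun n => ?_
  -- The subtracted power has derivative `K ρ ^ (-α) / 2`, the bound that the growth of `μ` gives
  -- for the derivative of the mean; the difference is therefore nonincreasing.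
  have hd : ∀ ρ ∈ Set.Ioo 0 R, HasDerivAt
      (fun ρ => smoothMean n u x R ρ - K / (2 * (1 - α)) * ρ ^ (1 - α))
      (ρ / (2 * ρ ^ d) * ∫ y, radialBump n x ρ y ∂μ -
        K / (2 * (1 - α)) * ((1 - α) * ρ ^ (1 - α - 1))) ρ := fun ρ hρ =>
    (hasDerivAt_smoothMean n hu hμ hρ.1 hρ.2 hR).sub
      ((Real.hasDerivAt_rpow_const (Or.inl hρ.1.ne')).const_mul _)
  have hanti := antitoneOn_of_deriv_nonpos (convex_Ioo 0 R)
    (fun ρ hρ => (hd ρ hρ).continuousAt.continuousWithinAt)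
    (fun ρ hρ => (hd ρ (interior_subset hρ)).differentiableAt.differentiableWithinAt)
    (fun ρ hρ => by
      have hρ' := interior_subset hρ
      have h0 := hρ'.1
      rw [(hd ρ hρ').deriv, sub_nonpos]
      have h1 := integral_radialBump_le n h0 (by positivity) (hg ρ h0 hρ'.2)
      refine (mul_le_mul_of_nonneg_left h1 (by positivity)).trans_eq ?_
      have h2 : ρ ^ ((d : ℝ) - 1 - α) = ρ ^ d * ρ ^ (1 - α - 1) / ρ := by
        rw [← Real.rpow_natCast ρ d, ← Real.rpow_add h0, eq_div_iff h0.ne',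
          ← Real.rpow_add_one h0.ne']
        congr 1; ring
      rw [h2]
      field_simp)
    ⟨hs, hsr.trans_lt hrR⟩ ⟨hs.trans_le hsr, hrR⟩ hsr
  have h3 : 0 ≤ K / (2 * (1 - α)) * s ^ (1 - α) := by positivity
  simp only at hanti
  linarith

theorem volume_real_ball {r : ℝ} (hr : 0 < r) :
    volume.real (Metric.ball x r) =
      r ^ d * volume.real (Metric.ball (0 : EuclideanSpace ℝ (Fin d)) 1) := by
  rw [measureReal_def, Measure.addHaar_ball_of_pos _ _ hr, ENNReal.toReal_mul,
    ENNReal.toReal_ofReal (by positivity), finrank_euclideanSpace_fin, measureReal_def]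

theorem volume_real_unitBall_pos (d : ℕ) :
    0 < volume.real (Metric.ball (0 : EuclideanSpace ℝ (Fin d)) 1) :=
  ENNReal.toReal_pos (Metric.measure_ball_pos volume _ one_pos).ne' measure_ball_lt_top.ne

theorem average_ball_eq {r : ℝ} (hr : 0 < r) :
    ⨍ y in Metric.ball x r, u y =
      (volume.real (Metric.ball (0 : EuclideanSpace ℝ (Fin d)) 1))⁻¹ *
        ((r ^ d)⁻¹ * ∫ y in Metric.ball x r, u y) := by
  rw [setAverage_eq, volume_real_ball hr, smul_eq_mul, mul_inv]
  ring

/-- If `|x-y| < r`, the ball about `x` of radius `r - |x-y|` lies in both balls, so the difference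
sits in a shell whose volume Bernoulli's inequality estimates. Otherwise the right side is at least
the volume of the full ball, because `d ≥ 1`. -/
theorem volume_real_ball_sdiff_ball_le (hd : 1 ≤ d) (x y : EuclideanSpace ℝ (Fin d)) {r : ℝ}
    (hr : 0 < r) :
    volume.real (Metric.ball x r \ Metric.ball y r) ≤
      d * (‖x - y‖ / r) * volume.real (Metric.ball x r) := by
  have hd' : (1 : ℝ) ≤ d := by exact_mod_cast hd
  rcases lt_or_ge ‖x - y‖ r with hxy | hxy
  · have hsub : Metric.ball x (r - ‖x - y‖) ⊆ Metric.ball x r :=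
      Metric.ball_subset_ball (by linarith [norm_nonneg (x - y)])
    have hsub' : Metric.ball x (r - ‖x - y‖) ⊆ Metric.ball y r :=
      Metric.ball_subset_ball' (by rw [dist_eq_norm]; linarith)
    have h1 : volume.real (Metric.ball x r \ Metric.ball y r) ≤
        volume.real (Metric.ball x r \ Metric.ball x (r - ‖x - y‖)) :=
      measureReal_mono (Set.sdiff_subset_sdiff_right hsub')
        ((measure_mono Set.sdiff_subset).trans_lt measure_ball_lt_top).ne
    refine h1.trans ?_
    rw [measureReal_sdiff hsub Metric.isOpen_ball.measurableSet measure_ball_lt_top.ne,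
      volume_real_ball hr,
      volume_real_ball (r := r - ‖x - y‖) (by linarith)]
    have h2 : -2 ≤ -(‖x - y‖ / r) := by
      have := (div_lt_one hr).2 hxy
      linarith
    have h3 := one_add_mul_le_pow h2 d
    have h4 : (r - ‖x - y‖) ^ d = r ^ d * (1 + -(‖x - y‖ / r)) ^ d := by
      rw [← mul_pow]; congr 1; field_simp; ring
    rw [h4]
    have h5 := mul_le_mul_of_nonneg_left h3
      (mul_nonneg (pow_nonneg hr.le d) (volume_real_unitBall_pos d).le)
    linarith
  · have h1 : 1 ≤ ‖x - y‖ / r := (one_le_div hr).2 hxy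
    refine (measureReal_mono Set.sdiff_subset measure_ball_lt_top.ne).trans ?_
    exact le_mul_of_one_le_left measureReal_nonneg (one_le_mul_of_one_le_of_one_le hd' h1)

/-- The integral over the common part is at most that over `ball y r` since `u ≥ 0` there; what
remains is at most `M` times the volume of `ball x r \ ball y r`. -/
theorem average_ball_sub_average_ball_le (hd : 1 ≤ d) {x y : EuclideanSpace ℝ (Fin d)} {r M : ℝ}
    (hr : 0 < r) (hx : IntegrableOn u (Metric.ball x r)) (hy : IntegrableOn u (Metric.ball y r))
    (hux : ∀ᵐ z ∂(volume.restrict (Metric.ball x r)), u z ≤ M)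
    (huy : ∀ᵐ z ∂(volume.restrict (Metric.ball y r)), 0 ≤ u z) (hM : 0 ≤ M) :
    (⨍ z in Metric.ball x r, u z) - (⨍ z in Metric.ball y r, u z) ≤ M * d * (‖x - y‖ / r) := by
  have hbx : MeasurableSet (Metric.ball x r) := Metric.isOpen_ball.measurableSet
  have hby : MeasurableSet (Metric.ball y r) := Metric.isOpen_ball.measurableSet
  have h1 : ∫ z in Metric.ball x r ∩ Metric.ball y r, u z ≤ ∫ z in Metric.ball y r, u z :=
    setIntegral_mono_set hy huy (Filter.Eventually.of_forall fun z hz => hz.2)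
  have h2 : ∫ z in Metric.ball x r \ Metric.ball y r, u z ≤
      M * volume.real (Metric.ball x r \ Metric.ball y r) := by
    have hfin : volume (Metric.ball x r \ Metric.ball y r) ≠ ⊤ :=
      ((measure_mono Set.sdiff_subset).trans_lt measure_ball_lt_top).ne
    refine (setIntegral_mono_ae_restrict (hx.mono_set Set.sdiff_subset) (integrableOn_const hfin)
      (ae_restrict_of_ae_restrict_of_subset Set.sdiff_subset hux)).trans_eq ?_
    rw [setIntegral_const, smul_eq_mul, mul_comm]
  have h3 := integral_inter_add_sdiff (μ := volume) hby hx
  have h4 := volume_real_ball_sdiff_ball_le hd x y hr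
  have hv : 0 < volume.real (Metric.ball y r) := by
    rw [volume_real_ball hr]; exact mul_pos (pow_pos hr d) (volume_real_unitBall_pos d)
  have hxy : volume.real (Metric.ball x r) = volume.real (Metric.ball y r) := by
    rw [volume_real_ball hr, volume_real_ball hr]
  rw [setAverage_eq, setAverage_eq, hxy, smul_eq_mul, smul_eq_mul, ← mul_sub,
    inv_mul_le_iff₀ hv]
  rw [hxy] at h4
  have h5 := mul_le_mul_of_nonneg_left h4 hM
  linarith

end BallMean

/-! ### Uniform room around the closure of the inner set. -/

section InnerSet

variable {d : ℕ} {D : TopologicalSpace.Opens (EuclideanSpace ℝ (Fin d))}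
  {x : EuclideanSpace ℝ (Fin d)} {δ : ℝ}

/-- The bound `δ ≤ infDist` survives passage to the closure, so the open ball misses the frontier of
`D`. Being connected, it cannot meet both `D` and the complement of its closure. -/
theorem ball_subset_of_mem_closure_innerSet (hδ : 0 < δ) (hx : x ∈ closure (innerSet D δ)) :
    Metric.ball x δ ⊆ D := by
  have h1 : δ ≤ Metric.infDist x (frontier (D : Set (EuclideanSpace ℝ (Fin d)))) :=
    closure_lt_subset_le continuous_const
      (Metric.continuous_infDist_pt (frontier (D : Set (EuclideanSpace ℝ (Fin d)))))
      (closure_mono (fun z hz => hz.2) hx)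
  have h2 : x ∈ closure (D : Set (EuclideanSpace ℝ (Fin d))) :=
    closure_mono (fun z hz => hz.1) hx
  have h3 : ∀ z ∈ Metric.ball x δ, z ∉ frontier (D : Set (EuclideanSpace ℝ (Fin d))) := by
    intro z hz hzf
    have := Metric.infDist_le_dist_of_mem (x := x) hzf
    rw [Metric.mem_ball'] at hz
    linarith
  have h4 : ∀ z ∈ Metric.ball x δ, z ∈ closure (D : Set (EuclideanSpace ℝ (Fin d))) → z ∈ D := by
    intro z hz hzc
    by_contra hzD
    exact h3 z hz ⟨hzc, by rwa [D.isOpen.interior_eq]⟩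
  refine IsPreconnected.subset_left_of_subset_union D.isOpen isClosed_closure.isOpen_compl
    (disjoint_compl_right.mono_left subset_closure) (fun z hz => ?_)
    ⟨x, Metric.mem_ball_self hδ, h4 x (Metric.mem_ball_self hδ) h2⟩
    (convex_ball x δ).isPreconnected
  by_cases hzc : z ∈ closure (D : Set (EuclideanSpace ℝ (Fin d)))
  · exact Or.inl (h4 z hz hzc)
  · exact Or.inr hzc

theorem closedBall_half_subset_of_mem_closure_innerSet (hδ : 0 < δ)
    (hx : x ∈ closure (innerSet D δ)) : Metric.closedBall x (δ / 2) ⊆ D :=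
  (Metric.closedBall_subset_ball (by linarith)).trans (ball_subset_of_mem_closure_innerSet hδ hx)

theorem isCompact_closure_innerSet (hD : Bornology.IsBounded (D : Set (EuclideanSpace ℝ (Fin d)))) :
    IsCompact (closure (innerSet D δ)) :=
  (hD.subset fun _ hz => hz.1).isCompact_closure

/-- A locally bounded function is bounded by a constant near the closure of `D_δ`. -/
theorem exists_ae_le_on_closedBall (hD : Bornology.IsBounded (D : Set (EuclideanSpace ℝ (Fin d))))
    {h : EuclideanSpace ℝ (Fin d) → ℝ} (hh : MemLinftyLoc D h) (hδ : 0 < δ) :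
    ∃ M : ℝ, 0 ≤ M ∧ ∀ x ∈ closure (innerSet D δ),
      ∀ᵐ z ∂(volume.restrict (Metric.closedBall x (δ / 2))), h z ≤ M := by
  have hc : IsCompact (Metric.cthickening (δ / 2) (closure (innerSet D δ))) :=
    (isCompact_closure_innerSet hD).cthickening
  -- Compactness makes the closed thickening a union of closed balls of radius `δ / 2`, each inside
  -- `D`. One essential supremum of `h` over it thus serves all centres.
  have hsub : Metric.cthickening (δ / 2) (closure (innerSet D δ)) ⊆ D := by
    rw [(isCompact_closure_innerSet hD).cthickening_eq_biUnion_closedBall (by linarith)]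
    exact Set.iUnion₂_subset fun x hx => closedBall_half_subset_of_mem_closure_innerSet hδ hx
  have hm := hh _ hc hsub
  refine ⟨(eLpNormEssSup h (volume.restrict
    (Metric.cthickening (δ / 2) (closure (innerSet D δ))))).toReal, ENNReal.toReal_nonneg, fun x hx => ?_⟩
  refine ae_restrict_of_ae_restrict_of_subset
    (Metric.closedBall_subset_cthickening hx (δ / 2)) ?_
  filter_upwards [ae_le_eLpNormEssSup (f := h)
    (μ := volume.restrict (Metric.cthickening (δ / 2) (closure (innerSet D δ))))] with z hz
  have hfin := hm.2
  rw [eLpNorm_exponent_top] at hfin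
  have h1 := ENNReal.toReal_mono hfin.ne hz
  rw [toReal_enorm] at h1
  exact (le_abs_self _).trans h1

end InnerSet

/-! ### Existence and rate of convergence of the averages. -/

section PreciseRepresentative

variable {d : ℕ} {D : TopologicalSpace.Opens (EuclideanSpace ℝ (Fin d))}
  {u : EuclideanSpace ℝ (Fin d) → ℝ} {μ : Measure (EuclideanSpace ℝ (Fin d))}

theorem exists_tendsto_average_ball (hu : LocallyIntegrableOn u D)
    (hμ : IsLaplacianMeasure D u μ)
    (hu0 : ∀ᵐ z ∂(volume.restrict (D : Set (EuclideanSpace ℝ (Fin d)))), 0 ≤ u z)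
    {x : EuclideanSpace ℝ (Fin d)} (hx : x ∈ D) :
    ∃ l : ℝ, Filter.Tendsto (fun r : ℝ => ⨍ y in Metric.ball x r, u y)
      (nhdsWithin 0 (Set.Ioi 0)) (nhds l) := by
  obtain ⟨R, hR, hRD⟩ := Metric.nhds_basis_closedBall.mem_iff.1 (D.isOpen.mem_nhds hx)
  have hbdd : BddBelow ((fun r => (r ^ d)⁻¹ * ∫ y in Metric.ball x r, u y) '' Set.Ioo 0 R) := by
    refine ⟨0, ?_⟩
    rintro _ ⟨r, hr, rfl⟩
    have hsub : Metric.ball x r ⊆ D :=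
      (Metric.ball_subset_closedBall.trans (Metric.closedBall_subset_closedBall hr.2.le)).trans hRD
    exact mul_nonneg (inv_nonneg.2 (pow_nonneg hr.1.le d))
      (integral_nonneg_of_ae (ae_restrict_of_ae_restrict_of_subset hsub hu0))
  have h1 := MonotoneOn.tendsto_nhdsWithin_Ioo_right (Set.nonempty_Ioo.2 hR)
    (scaled_integral_ball_mono hu hμ hRD) hbdd
  refine ⟨_, (h1.const_mul
    (volume.real (Metric.ball (0 : EuclideanSpace ℝ (Fin d)) 1))⁻¹).congr' ?_⟩
  filter_upwards [self_mem_nhdsWithin] with r hr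
  exact (average_ball_eq hr).symm

theorem average_closedBall_eq_average_ball (x : EuclideanSpace ℝ (Fin d)) {r : ℝ} (hr : r ≠ 0) :
    ⨍ y in Metric.closedBall x r, u y = ⨍ y in Metric.ball x r, u y := by
  have h : (Metric.closedBall x r : Set (EuclideanSpace ℝ (Fin d))) =ᵐ[volume]
      Metric.ball x r := by
    rw [← Metric.ball_union_sphere]
    exact union_ae_eq_left_of_ae_eq_empty
      (ae_eq_empty.2 (Measure.addHaar_sphere_of_ne_zero volume x hr))
  rw [Measure.restrict_congr_set h]

/-- Lebesgue differentiation is applied to the extension of `u` by zero, which has the same averages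
as `u` on small balls around points of `D`. -/
theorem ae_tendsto_average_ball (hu : IntegrableOn u D) :
    ∀ᵐ x ∂(volume.restrict (D : Set (EuclideanSpace ℝ (Fin d)))),
      Filter.Tendsto (fun r : ℝ => ⨍ y in Metric.ball x r, u y)
        (nhdsWithin 0 (Set.Ioi 0)) (nhds (u x)) := by
  have hi : Integrable ((D : Set (EuclideanSpace ℝ (Fin d))).indicator u) :=
    hu.integrable_indicator D.isOpen.measurableSet
  rw [ae_restrict_iff' D.isOpen.measurableSet]
  filter_upwards [(Besicovitch.vitaliFamily volume).ae_tendsto_average hi.locallyIntegrable]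
    with x hx hxD
  have h1 := hx.comp (Besicovitch.tendsto_filterAt volume x)
  rw [Set.indicator_of_mem hxD] at h1
  refine h1.congr' ?_
  obtain ⟨R, hR, hRD⟩ := Metric.nhds_basis_ball.mem_iff.1 (D.isOpen.mem_nhds hxD)
  filter_upwards [Ioo_mem_nhdsGT hR] with r hr
  rw [Function.comp_apply, average_closedBall_eq_average_ball x hr.1.ne']
  refine setAverage_congr_fun Metric.isOpen_ball.measurableSet
    (Filter.Eventually.of_forall fun y hy => ?_)
  exact Set.indicator_of_mem (hRD (Metric.ball_subset_ball hr.2.le hy)) u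

/-- Both bounds compare radii `s < r` and let `s → 0`: monotonicity gives the first, the growth of
`μ` the second. -/
theorem average_ball_sub_limit_mem (hu : LocallyIntegrableOn u D)
    (hμ : IsLaplacianMeasure D u μ) {x : EuclideanSpace ℝ (Fin d)} {R K α l : ℝ}
    (hR : Metric.closedBall x R ⊆ D) (hK : 0 ≤ K) (hα : α < 1)
    (hg : ∀ r, 0 < r → r < R →
      μ (Metric.ball x r) ≤ ENNReal.ofReal (K * r ^ ((d : ℝ) - 1 - α)))
    (hl : Filter.Tendsto (fun r : ℝ => ⨍ y in Metric.ball x r, u y)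
      (nhdsWithin 0 (Set.Ioi 0)) (nhds l)) {r : ℝ} (hr : 0 < r) (hrR : r < R) :
    l ≤ ⨍ y in Metric.ball x r, u y ∧ (⨍ y in Metric.ball x r, u y) - l ≤
      (volume.real (Metric.ball (0 : EuclideanSpace ℝ (Fin d)) 1))⁻¹ *
        (K / (2 * (1 - α))) * r ^ (1 - α) := by
  have hω := inv_nonneg.2 (volume_real_unitBall_pos d).le
  constructor
  · refine le_of_tendsto hl ?_
    filter_upwards [Ioo_mem_nhdsGT hr] with s hs
    rw [average_ball_eq hs.1, average_ball_eq hr]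
    exact mul_le_mul_of_nonneg_left (scaled_integral_ball_mono hu hμ hR
      ⟨hs.1, hs.2.trans hrR⟩ ⟨hr, hrR⟩ hs.2.le) hω
  · refine le_of_tendsto (hl.const_sub _) ?_
    filter_upwards [Ioo_mem_nhdsGT hr] with s hs
    rw [average_ball_eq hs.1, average_ball_eq hr, ← mul_sub, mul_assoc]
    exact mul_le_mul_of_nonneg_left
      (scaled_integral_ball_sub_le hu hμ hR hK hα hg hs.1 hs.2.le hrR) hω

end PreciseRepresentative

/-! ### The Hölder estimate. -/

theorem lemma3p4 (d : ℕ) (hd : 1 ≤ d)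
    (D : TopologicalSpace.Opens (EuclideanSpace ℝ (Fin d)))
    (hD : Bornology.IsBounded (D : Set (EuclideanSpace ℝ (Fin d))))
    (h : EuclideanSpace ℝ (Fin d) → ℝ) (hh : MemLinftyLoc D h)
    (δ K α : ℝ) (hδ : 0 < δ) (hK : 0 < K) (hα₀ : 0 ≤ α) (hα₁ : α < 1) :
    ∃ C : ℝ, ∀ u : EuclideanSpace ℝ (Fin d) → ℝ, MemH1 D u →
      (∀ᵐ x ∂(volume.restrict (D : Set (EuclideanSpace ℝ (Fin d)))), 0 ≤ u x ∧ u x ≤ h x) →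
      ∀ hu : IsSubharmonicIn D u,
        (∀ x₀ ∈ closure (innerSet D δ), ∀ r : ℝ, 0 < r → r < δ / 2 →
          laplacianMeasure D u hu (Metric.ball x₀ r) ≤
            ENNReal.ofReal (K * r ^ ((d : ℝ) - 1 - α))) →
        ∃ v : EuclideanSpace ℝ (Fin d) → ℝ, IsPreciseRepresentative D u v ∧
          ∀ x ∈ closure (innerSet D δ), ∀ y ∈ closure (innerSet D δ),
            |v x - v y| ≤ C * ‖x - y‖ ^ ((1 - α) / (2 - α)) := by
  obtain ⟨M, hM, hhM⟩ := exists_ae_le_on_closedBall hD hh hδ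
  obtain ⟨T, hT, hTD⟩ : ∃ T : ℝ, 0 < T ∧ ∀ x ∈ closure (innerSet D δ),
      ∀ y ∈ closure (innerSet D δ), ‖x - y‖ ≤ T := by
    obtain ⟨T, hT⟩ := Metric.isBounded_iff.1 (isCompact_closure_innerSet (δ := δ) hD).isBounded
    refine ⟨max T 1, by positivity, fun x hx y hy => ?_⟩
    rw [← dist_eq_norm]
    exact (hT hx hy).trans (le_max_left _ _)
  have hα' : 0 < 1 - α := by linarith
  have hα2 : 0 < 2 - α := by linarith
  set c := (volume.real (Metric.ball (0 : EuclideanSpace ℝ (Fin d)) 1))⁻¹ *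
    (K / (2 * (1 - α)))
  -- averages over balls of radius `κ * |x - y| ^ (1 / (2 - α))` are compared
  set κ := δ / 4 / T ^ (1 / (2 - α)) with hκ
  have hκ0 : 0 < κ := by positivity
  -- The first term comes from replacing an average by its limit, the second from moving the centre
  -- of the ball. Neither involves `u`.
  refine ⟨c * κ ^ (1 - α) + M * d / κ, fun u huH hu0h hu hg => ?_⟩
  have hμ := isLaplacianMeasure_laplacianMeasure hu
  have hloc := hu.locallyIntegrableOn
  -- On a bounded set square integrability implies integrability.
  have huD : IntegrableOn u D := by
    have : IsFiniteMeasure (volume.restrict (D : Set (EuclideanSpace ℝ (Fin d)))) :=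
      ⟨by simpa using hD.measure_lt_top⟩
    exact huH.1.integrable (by norm_num)
  have hu0 := hu0h.mono fun _ hz => hz.1
  have hlim : ∀ x : EuclideanSpace ℝ (Fin d), ∃ l : ℝ, x ∈ D →
      Filter.Tendsto (fun r : ℝ => ⨍ y in Metric.ball x r, u y)
        (nhdsWithin 0 (Set.Ioi 0)) (nhds l) := fun x => by
    by_cases hx : x ∈ D
    · exact (exists_tendsto_average_ball hloc hμ hu0 hx).imp fun _ hl _ => hl
    · exact ⟨0, fun h => absurd h hx⟩
  choose v hv using hlim
  refine ⟨v, ⟨?_, hv⟩, ?_⟩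
  · filter_upwards [ae_tendsto_average_ball huD, ae_restrict_mem D.isOpen.measurableSet]
      with x hx hxD
    exact tendsto_nhds_unique (hv x hxD) hx
  -- A one-sided estimate suffices by symmetry: `v x` is at most its average, and only the average
  -- at `y` has to be compared with its limit `v y`.
  have hoff : ∀ x ∈ closure (innerSet D δ), ∀ y ∈ closure (innerSet D δ), x ≠ y →
      v x - v y ≤ (c * κ ^ (1 - α) + M * d / κ) * ‖x - y‖ ^ ((1 - α) / (2 - α)) := by
    intro x hx y hy hxy
    have ht : 0 < ‖x - y‖ := norm_pos_iff.2 (sub_ne_zero.2 hxy)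
    set q := ‖x - y‖ ^ (1 / (2 - α)) with hq
    have hq0 : 0 < q := Real.rpow_pos_of_pos ht _
    have hr0 : 0 < κ * q := mul_pos hκ0 hq0
    -- Dividing by the power of the diameter bound `T` in `κ` keeps every radius at most `δ / 4`,
    -- within the range of the growth hypothesis.
    have hr : κ * q < δ / 2 := by
      have h1 : q ≤ T ^ (1 / (2 - α)) :=
        Real.rpow_le_rpow ht.le (hTD x hx y hy) (by positivity)
      have h2 : κ * q ≤ δ / 4 := by
        refine (mul_le_mul_of_nonneg_left h1 hκ0.le).trans_eq ?_
        rw [hκ, div_mul_cancel₀ _ (Real.rpow_pos_of_pos hT _).ne']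
      linarith
    have hxB := closedBall_half_subset_of_mem_closure_innerSet hδ hx
    have hyB := closedBall_half_subset_of_mem_closure_innerSet hδ hy
    have hsub : ∀ z : EuclideanSpace ℝ (Fin d),
        Metric.ball z (κ * q) ⊆ Metric.closedBall z (δ / 2) := fun z =>
      Metric.ball_subset_closedBall.trans (Metric.closedBall_subset_closedBall hr.le)
    have hvx := average_ball_sub_limit_mem hloc hμ hxB hK.le hα₁ (hg x hx)
      (hv x (hxB (Metric.mem_closedBall_self (by linarith)))) hr0 hr
    have hvy := average_ball_sub_limit_mem hloc hμ hyB hK.le hα₁ (hg y hy)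
      (hv y (hyB (Metric.mem_closedBall_self (by linarith)))) hr0 hr
    have hxy := average_ball_sub_average_ball_le hd (u := u) (x := x) (y := y) (M := M) hr0
      (huD.mono_set ((hsub x).trans hxB)) (huD.mono_set ((hsub y).trans hyB))
      (by
        filter_upwards [ae_restrict_of_ae_restrict_of_subset (hsub x) (hhM x hx),
          ae_restrict_of_ae_restrict_of_subset ((hsub x).trans hxB) hu0h] with z h1 h2
        exact h2.2.trans h1)
      (ae_restrict_of_ae_restrict_of_subset ((hsub y).trans hyB) hu0) hM
    have h1 : (κ * q) ^ (1 - α) = κ ^ (1 - α) * ‖x - y‖ ^ ((1 - α) / (2 - α)) := by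
      rw [Real.mul_rpow hκ0.le hq0.le, hq, ← Real.rpow_mul ht.le]
      congr 2; ring
    have h2 : ‖x - y‖ / (κ * q) = ‖x - y‖ ^ ((1 - α) / (2 - α)) / κ := by
      -- The exponents `(1-α)/(2-α)` and `1/(2-α)` add up to `1`; this is what balances the two
      -- errors.
      have h3 : ‖x - y‖ ^ ((1 - α) / (2 - α)) * q = ‖x - y‖ := by
        rw [hq, ← Real.rpow_add ht]
        convert Real.rpow_one _ using 2
        field_simp; ring
      rw [div_eq_div_iff hr0.ne' hκ0.ne']
      nth_rewrite 1 [← h3]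
      ring
    rw [h2] at hxy
    have h4 := hvy.2
    rw [h1] at h4
    have h5 : (c * κ ^ (1 - α) + M * d / κ) * ‖x - y‖ ^ ((1 - α) / (2 - α)) =
        c * (κ ^ (1 - α) * ‖x - y‖ ^ ((1 - α) / (2 - α))) +
          M * d * (‖x - y‖ ^ ((1 - α) / (2 - α)) / κ) := by ring
    rw [h5]
    linarith [hvx.1]
  intro x hx y hy
  rcases eq_or_ne x y with rfl | hxy
  · simp [Real.zero_rpow (div_pos hα' hα2).ne']
  · rw [abs_sub_le_iff]
    refine ⟨hoff x hx y hy hxy, ?_⟩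
    rw [norm_sub_rev]
    exact hoff y hy x hx hxy.symm
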